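/- Let $\mathbb K=\mathbb R$ or $\mathbb C$ and let $E$ be a locally convex Hausdorff space over $\mathbb K$ whose topology is given by a system of seminorms $(p_\alpha)_{\alpha\in\mathfrak A}$. Assume that $E$ is locally complete, i.e. for every closed, bounded, absolutely convex set $D\subset E$ the space $E_D=\bigcup_{n\in\mathbb N}nD$, normed by the gauge functional of $D$, is a Banach space. Let $G$ be a linear subspace of the dual $E'$ that determines boundedness, i.e. every set $B\subset E$ with $\sup_{x\in B}|e'(x)|<\infty$ for all $e'\in G$ is bounded in $E$. Let $\Omega\subset\mathbb R^d$ be open, $k\in\mathbb N_0$ and $0<\gamma\le 1$. A function $f\colon\Omega\to E$ is $\mathcal C^0$ if it is continuous; it is $\mathcal C^1$ if all its first partial derivatives exist in $E$ (as limits of difference quotients) at every point of $\Omega$ and are continuous on $\Omega$; and for $m\ge 1$ it is $\mathcal C^{m}$ if it is $\mathcal C^1$ and all its first partial derivatives are $\mathcal C^{m-1}$. Let $\mathcal C^{m}(\Omega,E)$ be the space of these functions, and let $\mathcal C^{k,\gamma}_{loc}(\Omega,E)$ be the space of all $f\in\mathcal C^k(\Omega,E)$ such that for every compact $K\subset\Omega$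 and every $\alpha\in\mathfrak A$ $$\sup_{x\in K,\ |\beta|\le k}p_\alpha(\partial^\beta f(x))<\infty\quad\text{and}\quad \sup_{|\beta|=k}\ \sup_{x,y\in K,\ x\ne y}\frac{p_\alpha(\partial^\beta f(x)-\partial^\beta f(y))}{|x-y|^\gamma}<\infty .$$ Write $\mathcal C^{m}(\Omega)$ and $\mathcal C^{k,\gamma}_{loc}(\Omega)$ for these spaces when $E=\mathbb K$ with the single seminorm $|\cdot|$. Let $f\colon\Omega\to E$. (a) If $e'\circ f\in\mathcal C^{k,\gamma}_{loc}(\Omega)$ for all $e'\in G$, then $f\in\mathcal C^{k,\gamma}_{loc}(\Omega,E)$. (b) If $e'\circ f\in\mathcal C^{k+1}(\Omega)$ for all $e'\in G$, then $f\in\mathcal C^{k,1}_{loc}(\Omega,E)$. -/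

import Mathlib

open Filter Topology

noncomputable section

namespace WeakStrong

section Spaces

/-- A disk: a bounded, absolutely convex set. Here absolutely convex means convex and balanced
over the scalar field `𝕜`, and bounded means absorbed by every neighbourhood of `0`. -/
structure IsDisk (𝕜 : Type*) {E : Type*} [RCLike 𝕜] [AddCommGroup E] [Module 𝕜 E]
    [Module ℝ E] [TopologicalSpace E] (D : Set E) : Prop where
  bounded : Bornology.IsVonNBounded 𝕜 D
  balanced : Balanced 𝕜 D
  convex : Convex ℝ D

/-- The carrier `⋃ n, n D` of the space `E_D` spanned by a disk `D`. -/
def diskSpan {E : Type*} [AddCommGroup E] [Module ℝ E] (D : Set E) : Set E :=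
  {x | ∃ n : ℕ, ∃ y ∈ D, x = (n : ℝ) • y}

/-- The space `E_D = ⋃ n, n D`, with the gauge of `D` as norm, is complete:
every sequence in `E_D` which is Cauchy for the gauge of `D` converges in `E_D` for it. -/
def DiskSpanComplete {E : Type*} [AddCommGroup E] [Module ℝ E] (D : Set E) : Prop :=
  ∀ u : ℕ → E, (∀ n, u n ∈ diskSpan D) →
    (∀ ε : ℝ, 0 < ε → ∃ N : ℕ, ∀ m ≥ N, ∀ n ≥ N, gauge D (u m - u n) < ε) →
    ∃ x ∈ diskSpan D, Tendsto (fun n => gauge D (u n - x)) atTop (𝓝 0)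

/-- `E` is locally complete: `E_D` is a Banach space for every closed disk `D`. -/
def LocallyComplete (𝕜 E : Type*) [RCLike 𝕜] [AddCommGroup E] [Module 𝕜 E]
    [Module ℝ E] [TopologicalSpace E] : Prop :=
  ∀ D : Set E, IsClosed D → IsDisk 𝕜 D → DiskSpanComplete D

/-- A linear subspace `G` of the dual determines boundedness: every subset of `E` which is bounded
for the weak topology `σ(E, G)` (each functional in `G` is bounded on it) is bounded in `E`. -/
def DeterminesBoundedness {𝕜 E : Type*} [RCLike 𝕜] [AddCommGroup E] [Module 𝕜 E]
    [TopologicalSpace E] (G : Submodule 𝕜 (StrongDual 𝕜 E)) : Prop :=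
  ∀ B : Set E, (∀ e' ∈ G, ∃ C : ℝ, ∀ x ∈ B, ‖e' x‖ ≤ C) → Bornology.IsVonNBounded 𝕜 B

end Spaces

section Differentiability

variable {d : ℕ} {E : Type*} [AddCommGroup E] [Module ℝ E] [TopologicalSpace E]

/-- The difference quotient of `f` at `x` in the direction of the `n`-th unit vector. -/
def diffQuot (n : Fin d) (f : EuclideanSpace ℝ (Fin d) → E) (x : EuclideanSpace ℝ (Fin d))
    (h : ℝ) : E :=
  h⁻¹ • (f (x + h • EuclideanSpace.single n (1 : ℝ)) - f x)

/-- The `n`-th partial derivative of `f` (an arbitrary value where the limit does not exist). -/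
def partialDeriv (n : Fin d) (f : EuclideanSpace ℝ (Fin d) → E) :
    EuclideanSpace ℝ (Fin d) → E :=
  fun x => limUnder (𝓝[≠] (0 : ℝ)) (diffQuot n f x)

/-- `f` is continuously partially differentiable on `Ω`: all first partial derivatives
exist at every point of `Ω` and are continuous on `Ω`. For open `Ω`, this only depends on
the restriction of `f` to `Ω`. -/
def IsC1On (Ω : Set (EuclideanSpace ℝ (Fin d))) (f : EuclideanSpace ℝ (Fin d) → E) : Prop :=
  ∀ n : Fin d,
    (∀ x ∈ Ω, ∃ v : E, Tendsto (diffQuot n f x) (𝓝[≠] (0 : ℝ)) (𝓝 v)) ∧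
      ContinuousOn (partialDeriv n f) Ω

/-- `f` is `k`-times continuously partially differentiable on `Ω`. -/
def IsCkOn (Ω : Set (EuclideanSpace ℝ (Fin d))) :
    ℕ → (EuclideanSpace ℝ (Fin d) → E) → Prop
  | 0, f => ContinuousOn f Ω
  | k + 1, f => IsC1On Ω f ∧ ∀ n : Fin d, IsCkOn Ω k (partialDeriv n f)

/-- The iterated partial derivative `∂^β = ∂₁^{β₁} ⋯ ∂_d^{β_d}` of `f`, the derivatives in the
last direction being taken first. -/
def multiDeriv (β : Fin d → ℕ) (f : EuclideanSpace ℝ (Fin d) → E) :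
    EuclideanSpace ℝ (Fin d) → E :=
  (List.finRange d).foldr (fun n g => (partialDeriv n)^[β n] g) f

/-- `f` is of class `C^{k,γ}_loc` on `Ω` (with respect to a system of seminorms `p` inducing the
topology of `E`): `f` is `C^k` on `Ω` and, for every compact `K ⊆ Ω` and every seminorm `p i`, the
suprema of `p i (∂^β f x)` over `x ∈ K`, `|β| ≤ k`, and of `p i (∂^β f x - ∂^β f y) / |x - y|^γ`
over `x, y ∈ K`, `x ≠ y`, `|β| = k`, are finite. -/
def IsCkHolderLocOn {𝕜 ι : Type*} [RCLike 𝕜] [Module 𝕜 E] (p : SeminormFamily 𝕜 E ι)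
    (Ω : Set (EuclideanSpace ℝ (Fin d))) (k : ℕ) (γ : ℝ)
    (f : EuclideanSpace ℝ (Fin d) → E) : Prop :=
  IsCkOn Ω k f ∧
    ∀ K : Set (EuclideanSpace ℝ (Fin d)), K ⊆ Ω → IsCompact K → ∀ i : ι,
      ∃ C : ℝ,
        (∀ β : Fin d → ℕ, ∑ n, β n ≤ k → ∀ x ∈ K, p i (multiDeriv β f x) ≤ C) ∧
        (∀ β : Fin d → ℕ, ∑ n, β n = k → ∀ x ∈ K, ∀ y ∈ K, x ≠ y →
          p i (multiDeriv β f x - multiDeriv β f y) / ‖x - y‖ ^ γ ≤ C)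

end Differentiability

/-- The system of seminorms `{|·|}` of the scalar field. -/
def absFamily (𝕜 : Type*) [RCLike 𝕜] : SeminormFamily 𝕜 𝕜 (Fin 1) :=
  fun _ => normSeminorm 𝕜 𝕜

end WeakStrong

end

/-! A subspace that determines boundedness turns weak estimates, with a constant depending on `e'`,
into estimates for every seminorm, with constants `M i`. Applied to the quotients of `f x - f y` by
`‖x - y‖ ^ γ`, this gives Hölder continuity at order zero (`holderOnCompacts_of_weak`). For a
partial derivative, let `Q t` be the difference quotient of `f` at `x`. If the partial derivative of
`e' ∘ f` is `γ`-Hölder, the mean value inequality puts `e' (Q t)` within `C * |t| ^ γ` of that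
derivative. Hence `e' (Q s - Q t)` is at most `C * (|s| ^ γ + |t| ^ γ)`, a bound in which no limit
in `E` appears. By the same principle `p i (Q s - Q t) ≤ M i * (|s| ^ γ + |t| ^ γ)`, so `Q` is
Cauchy for the gauge of the single closed disk `{p i ≤ M i for all i}`, and local completeness
supplies the limit (`LocallyComplete.exists_tendsto`, `exists_tendsto_diffQuot_of_weak`).
Functionals in `G` commute with the derivative so obtained, and induction on `k` concludes
(`iteratedHolder_of_weak`). The induction runs on `IteratedHolder`, which asks for the Hölder
condition at every order and for every sequence of directions. For scalar functions it follows from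
either hypothesis: `C^1` functions are Lipschitz on compact sets, which settles the lower orders
and, with exponent one, part (b); symmetry of second derivatives reduces any sequence of directions
to the fixed order in `multiDeriv`. -/

namespace WeakStrong

/-! ### Mean value inequality along lines. -/

section LineDerivatives

variable {V F : Type*} [NormedAddCommGroup V] [NormedSpace ℝ V]
  [NormedAddCommGroup F] [NormedSpace ℝ F]

lemma hasDerivAt_of_hasLineDerivAt {g : V → F} {v : F} {z e : V} {s : ℝ}
    (h : HasLineDerivAt ℝ g v (z + s • e) e) : HasDerivAt (fun t : ℝ => g (z + t • e)) v s := by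
  -- The base point `0` is written as `s - s` so that the translation rule applies.
  have h1 : HasDerivAt (fun t : ℝ => g (z + s • e + t • e)) v (s - s) := by
    simpa [HasLineDerivAt] using h
  have h2 := h1.comp_sub_const s s
  refine h2.congr_of_eventuallyEq (Eventually.of_forall fun t => ?_)
  simp only
  rw [add_assoc, ← add_smul]
  congr 3
  ring

/-- Mean value inequality along a segment. -/
lemma norm_sub_le_of_hasLineDerivAt {g : V → F} {g' : V → F} {z e : V} {a C : ℝ}
    (h : ∀ t ∈ Set.uIcc 0 a, HasLineDerivAt ℝ g (g' (z + t • e)) (z + t • e) e)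
    (hC : ∀ t ∈ Set.uIcc 0 a, ‖g' (z + t • e)‖ ≤ C) :
    ‖g (z + a • e) - g z‖ ≤ C * |a| := by
  have := (convex_uIcc (0 : ℝ) a).norm_image_sub_le_of_norm_hasDerivWithin_le
    (f := fun t : ℝ => g (z + t • e)) (f' := fun t => g' (z + t • e)) (C := C)
    (fun t ht => (hasDerivAt_of_hasLineDerivAt (h t ht)).hasDerivWithinAt) hC
    Set.left_mem_uIcc Set.right_mem_uIcc
  simpa using this

end LineDerivatives

/-! ### Continuous partial derivatives imply strict differentiability. -/

section Euclidean

variable {d : ℕ} {F : Type*} [NormedAddCommGroup F] [NormedSpace ℝ F]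

/-- The open cube with centre `c` and side length `2 r`. -/
def openCube (c : EuclideanSpace ℝ (Fin d)) (r : ℝ) : Set (EuclideanSpace ℝ (Fin d)) :=
  {z | ∀ i, |z i - c i| < r}

lemma openCube_mem_nhds (c : EuclideanSpace ℝ (Fin d)) {r : ℝ} (hr : 0 < r) :
    openCube c r ∈ 𝓝 c := by
  have : IsOpen (openCube c r) := by
    simp only [openCube, Set.ofPred_forall]
    exact isOpen_iInter_of_finite fun i => isOpen_lt (by fun_prop) continuous_const
  exact this.mem_nhds fun i => by simpa using hr

lemma exists_openCube_subset {c : EuclideanSpace ℝ (Fin d)} {U : Set (EuclideanSpace ℝ (Fin d))}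
    (hU : U ∈ 𝓝 c) : ∃ r > 0, openCube c r ⊆ U := by
  obtain ⟨ε, hε, hU⟩ := Metric.mem_nhds_iff.1 hU
  -- With `d + 1` the radius makes sense for `d = 0`, and the sum of `d` coordinate errors stays
  -- strictly below `ε`.
  refine ⟨ε / (d + 1), by positivity, fun z hz => hU ?_⟩
  have h1 : ‖z - c‖ ≤ ∑ i, |z i - c i| := by
    have h2 : z - c = ∑ i, (z i - c i) • EuclideanSpace.single i (1 : ℝ) := by
      ext j
      simp [Finset.sum_apply, Pi.single_apply]
    calc ‖z - c‖ = ‖∑ i, (z i - c i) • EuclideanSpace.single i (1 : ℝ)‖ := by rw [← h2]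
      _ ≤ ∑ i, ‖(z i - c i) • EuclideanSpace.single i (1 : ℝ)‖ := norm_sum_le _ _
      _ = _ := by simp [norm_smul]
  have h3 : ∑ i, |z i - c i| ≤ d * (ε / (d + 1)) := by
    calc ∑ i, |z i - c i| ≤ ∑ _i : Fin d, ε / (d + 1) := Finset.sum_le_sum fun i _ => (hz i).le
      _ = _ := by simp
  rw [Metric.mem_ball, dist_eq_norm]
  refine (h1.trans h3).trans_lt ?_
  rw [mul_div_assoc', div_lt_iff₀ (by positivity)]
  nlinarith

/-- Pass from `y` to `x` by changing one coordinate at a time, with `s` containing the coordinates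
still allowed to differ. Cubes are used because every such axis-parallel path stays inside them. -/
lemma norm_sub_le_sum_of_hasLineDerivAt {g : EuclideanSpace ℝ (Fin d) → F}
    {g' : Fin d → EuclideanSpace ℝ (Fin d) → F} {c : EuclideanSpace ℝ (Fin d)} {r C : ℝ}
    (h : ∀ z ∈ openCube c r, ∀ n,
      HasLineDerivAt ℝ g (g' n z) z (EuclideanSpace.single n (1 : ℝ)))
    (hC : ∀ z ∈ openCube c r, ∀ n, ‖g' n z‖ ≤ C) (s : Finset (Fin d)) :
    ∀ x ∈ openCube c r, ∀ y ∈ openCube c r, (∀ i ∉ s, x i = y i) →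
      ‖g x - g y‖ ≤ ∑ i ∈ s, C * |x i - y i| := by
  induction s using Finset.induction_on with
  | empty =>
    intro x _ y _ hxy
    have : x = y := by
      ext i
      exact hxy i (by simp)
    simp [this]
  | insert a s ha ih =>
    intro x hx y hy hxy
    set w := y + (x a - y a) • EuclideanSpace.single a (1 : ℝ) with hw
    have hwa : w a = x a := by simp [hw]
    have hwi : ∀ i, i ≠ a → w i = y i := fun i hi => by simp [hw, hi]
    have hseg : ∀ t ∈ Set.uIcc 0 (x a - y a),
        y + t • EuclideanSpace.single a (1 : ℝ) ∈ openCube c r := by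
      intro t ht i
      by_cases hi : i = a
      · subst hi
        have h1 := abs_lt.1 (hx i)
        have h2 := abs_lt.1 (hy i)
        simp only [PiLp.add_apply, PiLp.smul_apply, PiLp.single_apply, if_true,
          smul_eq_mul, mul_one]
        rcases Set.mem_uIcc.1 ht with ht | ht <;> exact abs_lt.2 ⟨by linarith, by linarith⟩
      · simpa [hi] using hy i
    have hwc : w ∈ openCube c r := hseg _ Set.right_mem_uIcc
    have h1 : ‖g w - g y‖ ≤ C * |x a - y a| :=
      norm_sub_le_of_hasLineDerivAt (g' := g' a) (fun t ht => h _ (hseg t ht) a)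
        (fun t ht => hC _ (hseg t ht) a)
    have h2 : ‖g x - g w‖ ≤ ∑ i ∈ s, C * |x i - w i| := by
      refine ih x hx w hwc fun i hi => ?_
      by_cases hia : i = a
      · rw [hia, hwa]
      · rw [hwi i hia]
        exact hxy i (by simp [hia, hi])
    have h3 : ∑ i ∈ s, C * |x i - w i| = ∑ i ∈ s, C * |x i - y i| :=
      Finset.sum_congr rfl fun i hi => by rw [hwi i (fun h => ha (h ▸ hi))]
    rw [Finset.sum_insert ha, ← h3]
    calc ‖g x - g y‖ = ‖(g w - g y) + (g x - g w)‖ := by congr 1; abel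
      _ ≤ _ := (norm_add_le _ _).trans (add_le_add h1 h2)

lemma norm_sub_le_of_hasLineDerivAt_single {g : EuclideanSpace ℝ (Fin d) → F}
    {g' : Fin d → EuclideanSpace ℝ (Fin d) → F} {c : EuclideanSpace ℝ (Fin d)} {r C : ℝ}
    (hC0 : 0 ≤ C)
    (h : ∀ z ∈ openCube c r, ∀ n,
      HasLineDerivAt ℝ g (g' n z) z (EuclideanSpace.single n (1 : ℝ)))
    (hC : ∀ z ∈ openCube c r, ∀ n, ‖g' n z‖ ≤ C)
    {x y : EuclideanSpace ℝ (Fin d)} (hx : x ∈ openCube c r) (hy : y ∈ openCube c r) :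
    ‖g x - g y‖ ≤ d * C * ‖x - y‖ := by
  refine (norm_sub_le_sum_of_hasLineDerivAt h hC Finset.univ x hx y hy (by simp)).trans ?_
  calc ∑ i, C * |x i - y i| ≤ ∑ _i : Fin d, C * ‖x - y‖ :=
        Finset.sum_le_sum fun i _ => mul_le_mul_of_nonneg_left (PiLp.norm_apply_le (x - y) i) hC0
    _ = _ := by simp [mul_assoc]

/-- The linear map with prescribed values on the standard basis. -/
noncomputable def linearOfPartials (v : Fin d → F) : EuclideanSpace ℝ (Fin d) →L[ℝ] F :=
  ∑ n, (EuclideanSpace.proj n : EuclideanSpace ℝ (Fin d) →L[ℝ] ℝ).smulRight (v n)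

lemma linearOfPartials_single (v : Fin d → F) (n : Fin d) :
    linearOfPartials v (EuclideanSpace.single n (1 : ℝ)) = v n := by
  simp [linearOfPartials]

/-- A function with continuous partial derivatives is strictly differentiable. -/
lemma hasStrictFDerivAt_of_partials {g : EuclideanSpace ℝ (Fin d) → F}
    {g' : Fin d → EuclideanSpace ℝ (Fin d) → F} {c : EuclideanSpace ℝ (Fin d)}
    (h : ∀ᶠ z in 𝓝 c, ∀ n,
      HasLineDerivAt ℝ g (g' n z) z (EuclideanSpace.single n (1 : ℝ)))
    (hc : ∀ n, ContinuousAt (g' n) c) :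
    HasStrictFDerivAt g (linearOfPartials fun n => g' n c) c := by
  rw [hasStrictFDerivAt_iff_isLittleO, Asymptotics.isLittleO_iff]
  intro ε hε
  have hδ : 0 < ε / (d + 1) := by positivity
  have hclose : ∀ᶠ z in 𝓝 c, ∀ n, ‖g' n z - g' n c‖ < ε / (d + 1) :=
    eventually_all.2 fun n => by
      simpa [dist_eq_norm] using Metric.tendsto_nhds.1 (hc n) _ hδ
  obtain ⟨r, hr, hsub⟩ := exists_openCube_subset (h.and hclose)
  set L := linearOfPartials fun n => g' n c with hL
  have hmem := openCube_mem_nhds c hr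
  filter_upwards [prod_mem_nhds hmem hmem] with p hp
  -- The partial derivatives of `g - L` are below `ε / (d + 1)` on the cube, so `g - L` has
  -- Lipschitz constant at most `ε` there.
  have key := norm_sub_le_of_hasLineDerivAt_single (g := fun z => g z - L z)
    (g' := fun n z => g' n z - g' n c) hδ.le
    (fun z hz n => by
      have h1 : HasLineDerivAt ℝ L (g' n c) z (EuclideanSpace.single n (1 : ℝ)) := by
        have := (L.hasFDerivAt (x := z)).hasLineDerivAt (EuclideanSpace.single n (1 : ℝ))
        rwa [hL, linearOfPartials_single] at this
      exact HasDerivAt.sub ((hsub hz).1 n) h1)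
    (fun z hz n => ((hsub hz).2 n).le) hp.1 hp.2
  calc ‖g p.1 - g p.2 - L (p.1 - p.2)‖ = ‖g p.1 - L p.1 - (g p.2 - L p.2)‖ := by
        rw [map_sub]
        congr 1
        abel
    _ ≤ d * (ε / (d + 1)) * ‖p.1 - p.2‖ := key
    _ ≤ ε * ‖p.1 - p.2‖ := by
        refine mul_le_mul_of_nonneg_right ?_ (norm_nonneg _)
        rw [mul_div_assoc', div_le_iff₀ (by positivity)]
        nlinarith

end Euclidean

/-! ### Consequences of `C^1` regularity, and symmetry of second derivatives. -/

section PartialDerivatives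

variable {d : ℕ} {F : Type*} [NormedAddCommGroup F] [NormedSpace ℝ F]
  {Ω : Set (EuclideanSpace ℝ (Fin d))} {g : EuclideanSpace ℝ (Fin d) → F}

lemma hasLineDerivAt_iff_tendsto_diffQuot {n : Fin d} {v : F} {x : EuclideanSpace ℝ (Fin d)} :
    HasLineDerivAt ℝ g v x (EuclideanSpace.single n (1 : ℝ)) ↔
      Tendsto (diffQuot n g x) (𝓝[≠] (0 : ℝ)) (𝓝 v) := by
  rw [HasLineDerivAt, hasDerivAt_iff_tendsto_slope_zero]
  simp only [zero_add, zero_smul, add_zero]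
  rfl

lemma IsC1On.hasLineDerivAt (hg : IsC1On Ω g) {x : EuclideanSpace ℝ (Fin d)} (hx : x ∈ Ω)
    (n : Fin d) :
    HasLineDerivAt ℝ g (partialDeriv n g x) x (EuclideanSpace.single n (1 : ℝ)) := by
  obtain ⟨v, hv⟩ := (hg n).1 x hx
  rw [hasLineDerivAt_iff_tendsto_diffQuot]
  rwa [partialDeriv, hv.limUnder_eq]

lemma IsC1On.hasStrictFDerivAt (hΩ : IsOpen Ω) (hg : IsC1On Ω g)
    {x : EuclideanSpace ℝ (Fin d)} (hx : x ∈ Ω) :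
    HasStrictFDerivAt g (linearOfPartials fun n => partialDeriv n g x) x :=
  hasStrictFDerivAt_of_partials
    (by filter_upwards [hΩ.mem_nhds hx] with z hz n using hg.hasLineDerivAt hz n)
    fun n => (hg n).2.continuousAt (hΩ.mem_nhds hx)

/-- Since `K` need not be convex, the mean value inequality does not apply globally; strict
differentiability gives local Lipschitz bounds, and compactness makes them uniform. -/
lemma IsC1On.exists_lipschitzOnWith (hΩ : IsOpen Ω) (hg : IsC1On Ω g)
    {K : Set (EuclideanSpace ℝ (Fin d))} (hK : K ⊆ Ω) (hKc : IsCompact K) :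
    ∃ C, LipschitzOnWith C g K := by
  refine LocallyLipschitzOn.exists_lipschitzOnWith_of_compact hKc fun x hx => ?_
  obtain ⟨C, s, hs, h⟩ := (hg.hasStrictFDerivAt hΩ (hK hx)).exists_lipschitzOnWith
  exact ⟨C, s, mem_nhdsWithin_of_mem_nhds hs, h⟩

/-- Symmetry of second partial derivatives. -/
lemma partialDeriv_comm (hΩ : IsOpen Ω) (hg : IsC1On Ω g)
    (hg' : ∀ n, IsC1On Ω (partialDeriv n g)) (a b : Fin d) :
    Set.EqOn (partialDeriv a (partialDeriv b g)) (partialDeriv b (partialDeriv a g)) Ω := by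
  intro x hx
  -- The candidate second derivative comes from differentiating each coefficient in the expansion of
  -- the first derivative along the coordinate projections.
  set f'' : EuclideanSpace ℝ (Fin d) →L[ℝ] EuclideanSpace ℝ (Fin d) →L[ℝ] F :=
    ∑ n, ((ContinuousLinearMap.smulRightL ℝ (EuclideanSpace ℝ (Fin d)) F)
      (EuclideanSpace.proj n : EuclideanSpace ℝ (Fin d) →L[ℝ] ℝ)).comp
      (linearOfPartials fun m => partialDeriv m (partialDeriv n g) x) with hf''
  have hd : HasFDerivAt (fun y => linearOfPartials fun n => partialDeriv n g y) f'' x := by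
    have := HasFDerivAt.fun_sum (u := Finset.univ) fun (n : Fin d) _ =>
      ((ContinuousLinearMap.smulRightL ℝ (EuclideanSpace ℝ (Fin d)) F)
        (EuclideanSpace.proj n : EuclideanSpace ℝ (Fin d) →L[ℝ] ℝ)).hasFDerivAt.comp x
        ((hg' n).hasStrictFDerivAt hΩ hx).hasFDerivAt
    exact this
  have hsymm := second_derivative_symmetric_of_eventually (𝕜 := ℝ)
    (by filter_upwards [hΩ.mem_nhds hx] with y hy using
      (hg.hasStrictFDerivAt hΩ hy).hasFDerivAt) hd
  have hval : ∀ a b : Fin d, f'' (EuclideanSpace.single a (1 : ℝ))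
      (EuclideanSpace.single b (1 : ℝ)) = partialDeriv a (partialDeriv b g) x := by
    intro a b
    rw [hf'', sum_apply, sum_apply]
    simp [linearOfPartials_single]
  rw [← hval, ← hval, hsymm]

end PartialDerivatives

/-! ### Iterated partial derivatives along lists of directions. -/

section IteratedPartials

variable {d : ℕ} {E : Type*} [AddCommGroup E] [Module ℝ E]
  {Ω : Set (EuclideanSpace ℝ (Fin d))} {f g : EuclideanSpace ℝ (Fin d) → E}

lemma diffQuot_eventuallyEq (hΩ : IsOpen Ω) (h : Set.EqOn f g Ω) (n : Fin d)
    {x : EuclideanSpace ℝ (Fin d)} (hx : x ∈ Ω) :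
    diffQuot n f x =ᶠ[𝓝[≠] 0] diffQuot n g x := by
  have hc : Tendsto (fun t : ℝ => x + t • EuclideanSpace.single n (1 : ℝ)) (𝓝 0) (𝓝 x) := by
    have : Continuous fun t : ℝ => x + t • EuclideanSpace.single n (1 : ℝ) := by fun_prop
    simpa using this.tendsto 0
  filter_upwards [nhdsWithin_le_nhds (hc (hΩ.mem_nhds hx))] with t ht
  simp only [diffQuot]
  rw [h hx, h ht]

variable [TopologicalSpace E]

lemma partialDeriv_eqOn (hΩ : IsOpen Ω) (h : Set.EqOn f g Ω) (n : Fin d) :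
    Set.EqOn (partialDeriv n f) (partialDeriv n g) Ω := fun x hx => by
  simp only [partialDeriv, limUnder]
  rw [map_congr (diffQuot_eventuallyEq hΩ h n hx)]

/-- The iterated partial derivative in the directions of a list, the last entry first. -/
noncomputable def iterPartial (l : List (Fin d)) (f : EuclideanSpace ℝ (Fin d) → E) :
    EuclideanSpace ℝ (Fin d) → E :=
  l.foldr partialDeriv f

lemma multiDeriv_eq_iterPartial (β : Fin d → ℕ) (f : EuclideanSpace ℝ (Fin d) → E) :
    multiDeriv β f =
      iterPartial ((List.finRange d).flatMap fun n => List.replicate (β n) n) f := by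
  have hrep : ∀ (n : Fin d) (m : ℕ) (g : EuclideanSpace ℝ (Fin d) → E),
      (List.replicate m n).foldr partialDeriv g = (partialDeriv n)^[m] g := by
    intro n m g
    induction m with
    | zero => rfl
    | succ m ih => rw [List.replicate_succ, List.foldr_cons, ih, Function.iterate_succ_apply']
  unfold multiDeriv iterPartial
  induction List.finRange d with
  | nil => rfl
  | cons a l ih => rw [List.foldr_cons, ih, List.flatMap_cons, List.foldr_append, hrep]

lemma length_flatMap_replicate (β : Fin d → ℕ) :
    ((List.finRange d).flatMap fun n => List.replicate (β n) n).length = ∑ n, β n := by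
  rw [List.length_flatMap, ← Fin.sum_univ_def]
  simp

lemma count_flatMap_replicate (β : Fin d → ℕ) (a : Fin d) :
    ((List.finRange d).flatMap fun n => List.replicate (β n) n).count a = β a := by
  rw [List.count_flatMap, Function.comp_def, ← Fin.sum_univ_def]
  simp [List.count_replicate]

lemma perm_flatMap_replicate_count (l : List (Fin d)) :
    l.Perm ((List.finRange d).flatMap fun n => List.replicate (l.count n) n) := by
  rw [List.perm_iff_count]
  exact fun a => (count_flatMap_replicate (fun n => l.count n) a).symm

lemma IsCkOn.iterPartial {j : ℕ} (l : List (Fin d)) (h : IsCkOn Ω (j + l.length) f) :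
    IsCkOn Ω j (iterPartial l f) := by
  induction l generalizing j with
  | nil => exact h
  | cons a l ih =>
    have : IsCkOn Ω (j + 1 + l.length) f := by
      rwa [List.length_cons, add_comm l.length, ← add_assoc] at h
    exact (ih this).2 a

end IteratedPartials

/-! ### Independence of the order of differentiation. -/

section Normed

variable {d : ℕ} {F : Type*} [NormedAddCommGroup F] [NormedSpace ℝ F]
  {Ω : Set (EuclideanSpace ℝ (Fin d))} {g : EuclideanSpace ℝ (Fin d) → F}

/-- `IsC1On` does not include continuity of the function itself; at the bottom order it is recovered
from strict differentiability. -/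
lemma IsCkOn.of_succ (hΩ : IsOpen Ω) {k : ℕ} {g : EuclideanSpace ℝ (Fin d) → F}
    (h : IsCkOn Ω (k + 1) g) : IsCkOn Ω k g := by
  induction k generalizing g with
  | zero => exact fun x hx => (h.1.hasStrictFDerivAt hΩ hx).continuousAt.continuousWithinAt
  | succ k ih => exact ⟨h.1, fun n => ih (h.2 n)⟩

/-- A permutation is generated by adjacent swaps, each an instance of `partialDeriv_comm`. Equality
holds only on `Ω`, and it survives further differentiation because `Ω` is open. -/
lemma iterPartial_eqOn_of_perm (hΩ : IsOpen Ω) {l l' : List (Fin d)} (hl : l.Perm l')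
    (hg : IsCkOn Ω l.length g) : Set.EqOn (iterPartial l g) (iterPartial l' g) Ω := by
  induction hl with
  | nil => exact fun _ _ => rfl
  | cons a _ ih => exact partialDeriv_eqOn hΩ (ih (IsCkOn.of_succ hΩ hg)) a
  | swap a b l =>
    have h2 : IsCkOn Ω 2 (iterPartial l g) := IsCkOn.iterPartial l (by
      rwa [add_comm 2])
    exact partialDeriv_comm hΩ h2.1 (fun n => (h2.2 n).1) b a
  | trans h₁ _ ih₁ ih₂ => exact (ih₁ hg).trans (ih₂ (h₁.length_eq ▸ hg))

end Normed

/-! ### Hölder conditions on compact sets, at all orders. -/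

section Holder

variable {d : ℕ} {𝕜 ι E : Type*} [RCLike 𝕜] [AddCommGroup E] [Module 𝕜 E]
  {Ω : Set (EuclideanSpace ℝ (Fin d))} {γ : ℝ} {f g : EuclideanSpace ℝ (Fin d) → E}

/-- `f` is Hölder continuous with exponent `γ` on every compact subset of `Ω`. -/
def HolderOnCompacts (p : SeminormFamily 𝕜 E ι) (Ω : Set (EuclideanSpace ℝ (Fin d))) (γ : ℝ)
    (f : EuclideanSpace ℝ (Fin d) → E) : Prop :=
  ∀ K : Set (EuclideanSpace ℝ (Fin d)), K ⊆ Ω → IsCompact K → ∀ i : ι,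
    ∃ C : ℝ, ∀ x ∈ K, ∀ y ∈ K, p i (f x - f y) ≤ C * ‖x - y‖ ^ γ

variable {p : SeminormFamily 𝕜 E ι}

lemma HolderOnCompacts.congr (hf : HolderOnCompacts p Ω γ f) (h : Set.EqOn f g Ω) :
    HolderOnCompacts p Ω γ g := fun K hK hKc i => by
  obtain ⟨C, hC⟩ := hf K hK hKc i
  exact ⟨C, fun x hx y hy => by rw [← h (hK hx), ← h (hK hy)]; exact hC x hx y hy⟩

lemma HolderOnCompacts.continuousOn [TopologicalSpace E]
    (hp : WithSeminorms p) (hΩ : IsOpen Ω) (hγ : 0 < γ) (hf : HolderOnCompacts p Ω γ f) :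
    ContinuousOn f Ω := fun x hx => by
  refine ContinuousAt.continuousWithinAt ?_
  obtain ⟨K, hKc, hxK, hK⟩ := exists_compact_subset hΩ hx
  refine (hp.tendsto_nhds f (f x)).2 fun i ε hε => ?_
  obtain ⟨C, hC⟩ := hf K hK hKc i
  have hlim : Tendsto (fun y => C * ‖y - x‖ ^ γ) (𝓝 x) (𝓝 0) := by
    have : Continuous fun y => C * ‖y - x‖ ^ γ :=
      continuous_const.mul ((continuous_id.sub continuous_const).norm.rpow_const
        fun _ => Or.inr hγ.le)
    simpa [Real.zero_rpow hγ.ne'] using this.tendsto x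
  filter_upwards [hlim.eventually_lt_const hε, mem_interior_iff_mem_nhds.1 hxK] with y hy hyK
  exact (hC y hyK x (interior_subset hxK)).trans_lt hy

variable [Module ℝ E] [TopologicalSpace E]

/-- All partial derivatives of `f` of order at most `k` exist on `Ω` and are Hölder continuous
with exponent `γ` on the compact subsets of `Ω`. -/
def IteratedHolder (p : SeminormFamily 𝕜 E ι) (Ω : Set (EuclideanSpace ℝ (Fin d))) (γ : ℝ) :
    ℕ → (EuclideanSpace ℝ (Fin d) → E) → Prop
  | 0, f => HolderOnCompacts p Ω γ f
  | k + 1, f => HolderOnCompacts p Ω γ f ∧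
      (∀ n : Fin d, ∀ x ∈ Ω, ∃ v : E, Tendsto (diffQuot n f x) (𝓝[≠] (0 : ℝ)) (𝓝 v)) ∧
      ∀ n : Fin d, IteratedHolder p Ω γ k (partialDeriv n f)

lemma IteratedHolder.holderOnCompacts {k : ℕ} (h : IteratedHolder p Ω γ k f) :
    HolderOnCompacts p Ω γ f := by
  cases k with
  | zero => exact h
  | succ k => exact h.1

lemma IteratedHolder.congr (hΩ : IsOpen Ω) {k : ℕ} (hf : IteratedHolder p Ω γ k f)
    (h : Set.EqOn f g Ω) : IteratedHolder p Ω γ k g := by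
  induction k generalizing f g with
  | zero => exact HolderOnCompacts.congr hf h
  | succ k ih =>
    refine ⟨hf.1.congr h, fun n x hx => ?_, fun n => ih (hf.2.2 n) (partialDeriv_eqOn hΩ h n)⟩
    obtain ⟨v, hv⟩ := hf.2.1 n x hx
    exact ⟨v, hv.congr' (diffQuot_eventuallyEq hΩ h n hx)⟩

lemma IteratedHolder.iterPartial {j : ℕ} (l : List (Fin d))
    (h : IteratedHolder p Ω γ (j + l.length) f) : IteratedHolder p Ω γ j (iterPartial l f) := by
  induction l generalizing j with
  | nil => exact h
  | cons a l ih =>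
    have : IteratedHolder p Ω γ (j + 1 + l.length) f := by
      rwa [List.length_cons, add_comm l.length, ← add_assoc] at h
    exact (ih this).2.2 a

lemma IteratedHolder.of_succ {k : ℕ} (h : IteratedHolder p Ω γ (k + 1) f) :
    IteratedHolder p Ω γ k f := by
  induction k generalizing f with
  | zero => exact h.1
  | succ k ih => exact ⟨h.1, h.2.1, fun n => ih (h.2.2 n)⟩

lemma IteratedHolder.mono {j k : ℕ} (hjk : j ≤ k) (h : IteratedHolder p Ω γ k f) :
    IteratedHolder p Ω γ j f := by
  induction hjk with
  | refl => exact h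
  | step _ ih => exact ih h.of_succ

lemma IteratedHolder.isCkOn (hp : WithSeminorms p) (hΩ : IsOpen Ω) (hγ : 0 < γ) {k : ℕ}
    (h : IteratedHolder p Ω γ k f) : IsCkOn Ω k f := by
  induction k generalizing f with
  | zero => exact HolderOnCompacts.continuousOn hp hΩ hγ h
  | succ k ih =>
    exact ⟨fun n => ⟨h.2.1 n, (h.2.2 n).holderOnCompacts.continuousOn hp hΩ hγ⟩,
      fun n => ih (h.2.2 n)⟩

lemma IteratedHolder.holderOnCompacts_multiDeriv {k : ℕ} (h : IteratedHolder p Ω γ k f)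
    (β : Fin d → ℕ) (hβ : ∑ n, β n ≤ k) : HolderOnCompacts p Ω γ (multiDeriv β f) := by
  rw [multiDeriv_eq_iterPartial]
  exact (IteratedHolder.iterPartial (j := 0) _
    (h.mono (by rwa [zero_add, length_flatMap_replicate]))).holderOnCompacts

lemma IteratedHolder.isCkHolderLocOn (hp : WithSeminorms p) (hΩ : IsOpen Ω) (hγ : 0 < γ) {k : ℕ}
    (h : IteratedHolder p Ω γ k f) : IsCkHolderLocOn p Ω k γ f := by
  refine ⟨h.isCkOn hp hΩ hγ, fun K hK hKc i => ?_⟩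
  -- Finitely many multi-indices occur, so the constants found for each have a common bound.
  have hfin : {β : Fin d → ℕ | ∑ n, β n ≤ k}.Finite := by
    refine (Set.Finite.pi' fun _ : Fin d => Set.finite_Iic k).subset fun β hβ n => ?_
    exact (Finset.single_le_sum (fun _ _ => Nat.zero_le _) (Finset.mem_univ n)).trans hβ
  have hex : ∀ β : Fin d → ℕ, ∃ C : ℝ, ∑ n, β n ≤ k →
      (∀ x ∈ K, p i (multiDeriv β f x) ≤ C) ∧
      ∀ x ∈ K, ∀ y ∈ K, x ≠ y →
        p i (multiDeriv β f x - multiDeriv β f y) / ‖x - y‖ ^ γ ≤ C := by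
    intro β
    by_cases hβ : ∑ n, β n ≤ k
    · have hh := h.holderOnCompacts_multiDeriv β hβ
      have hcont : ContinuousOn (fun x => p i (multiDeriv β f x)) K :=
        (hp.continuous_seminorm i).comp_continuousOn ((hh.continuousOn hp hΩ hγ).mono hK)
      obtain ⟨C₁, hC₁⟩ := hKc.exists_bound_of_continuousOn hcont
      obtain ⟨C₂, hC₂⟩ := hh K hK hKc i
      refine ⟨max C₁ C₂, fun _ => ⟨fun x hx => ?_, fun x hx y hy hxy => ?_⟩⟩
      · exact (le_abs_self _).trans ((hC₁ x hx).trans (le_max_left _ _))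
      · rw [div_le_iff₀ (Real.rpow_pos_of_pos (norm_pos_iff.2 (sub_ne_zero.2 hxy)) _)]
        exact (hC₂ x hx y hy).trans
          (mul_le_mul_of_nonneg_right (le_max_right _ _) (Real.rpow_nonneg (norm_nonneg _) _))
    · exact ⟨0, fun h => absurd h hβ⟩
  choose C hC using hex
  obtain ⟨M, hM⟩ := (hfin.image C).bddAbove
  have hCM : ∀ β : Fin d → ℕ, ∑ n, β n ≤ k → C β ≤ M := fun β hβ =>
    hM (Set.mem_image_of_mem C hβ)
  exact ⟨M, fun β hβ x hx => ((hC β hβ).1 x hx).trans (hCM β hβ),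
    fun β hβ x hx y hy hxy => ((hC β hβ.le).2 x hx y hy hxy).trans (hCM β hβ.le)⟩

end Holder

/-! ### Scalar functions satisfy the iterated Hölder condition. -/

section Scalar

variable {d : ℕ} {𝕜 : Type*} [RCLike 𝕜] {Ω : Set (EuclideanSpace ℝ (Fin d))} {γ : ℝ}
  {g : EuclideanSpace ℝ (Fin d) → 𝕜}

lemma IsC1On.holderOnCompacts (hΩ : IsOpen Ω) (hγ : γ ≤ 1) (hγ₀ : 0 < γ) (hg : IsC1On Ω g) :
    HolderOnCompacts (absFamily 𝕜) Ω γ g := fun K hK hKc _ => by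
  obtain ⟨C, hC⟩ := hg.exists_lipschitzOnWith hΩ hK hKc
  obtain ⟨R, hR⟩ := Metric.isBounded_iff.1 hKc.isBounded
  -- `R` bounds the distances in `K`; the Lipschitz bound becomes a Hölder bound by absorbing the
  -- spare factor `‖x - y‖ ^ (1 - γ)`.
  refine ⟨C * R ^ (1 - γ), fun x hx y hy => ?_⟩
  change ‖g x - g y‖ ≤ _
  have h1 : ‖g x - g y‖ ≤ C * ‖x - y‖ := by
    simpa [dist_eq_norm] using hC.dist_le_mul x hx y hy
  rcases eq_or_ne x y with rfl | hxy
  · simp [Real.zero_rpow hγ₀.ne']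
  have hpos : 0 < ‖x - y‖ := norm_pos_iff.2 (sub_ne_zero.2 hxy)
  have h2 : ‖x - y‖ ≤ R := by simpa [dist_eq_norm] using hR hx hy
  have h3 : ‖x - y‖ = ‖x - y‖ ^ (1 - γ) * ‖x - y‖ ^ γ := by
    rw [← Real.rpow_add hpos]
    simp
  have h4 : ‖x - y‖ ^ (1 - γ) ≤ R ^ (1 - γ) := Real.rpow_le_rpow hpos.le h2 (by linarith)
  calc ‖g x - g y‖ ≤ C * ‖x - y‖ := h1
    _ = C * ‖x - y‖ ^ (1 - γ) * ‖x - y‖ ^ γ := by rw [mul_assoc, ← h3]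
    _ ≤ C * R ^ (1 - γ) * ‖x - y‖ ^ γ := by gcongr

/-- Only the top order needs an assumption: a derivative of lower order is itself `C^1`, hence
Hölder on compact sets. -/
lemma IsCkOn.iteratedHolder (hΩ : IsOpen Ω) (hγ : γ ≤ 1) (hγ₀ : 0 < γ) {k : ℕ}
    (hg : IsCkOn Ω k g)
    (h : ∀ l : List (Fin d), l.length = k →
      HolderOnCompacts (absFamily 𝕜) Ω γ (WeakStrong.iterPartial l g)) :
    IteratedHolder (absFamily 𝕜) Ω γ k g := by
  induction k generalizing g with
  | zero => exact h [] rfl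
  | succ k ih =>
    refine ⟨hg.1.holderOnCompacts hΩ hγ hγ₀, fun n => (hg.1 n).1, fun n => ih (hg.2 n) ?_⟩
    intro l hl
    -- The last entry of a list is differentiated first, so `n` is appended at the end.
    have := h (l ++ [n]) (by simp [hl])
    rwa [WeakStrong.iterPartial, List.foldr_append] at this

lemma IsCkHolderLocOn.iteratedHolder (hΩ : IsOpen Ω) (hγ : γ ≤ 1) (hγ₀ : 0 < γ) {k : ℕ}
    (hg : IsCkHolderLocOn (absFamily 𝕜) Ω k γ g) : IteratedHolder (absFamily 𝕜) Ω γ k g := by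
  refine hg.1.iteratedHolder hΩ hγ hγ₀ fun l hl => ?_
  have hperm := perm_flatMap_replicate_count l
  have heq := iterPartial_eqOn_of_perm hΩ hperm (hl ▸ hg.1)
  rw [← multiDeriv_eq_iterPartial] at heq
  refine HolderOnCompacts.congr (fun K hK hKc i => ?_) heq.symm
  obtain ⟨C, -, hC⟩ := hg.2 K hK hKc i
  refine ⟨C, fun x hx y hy => ?_⟩
  rcases eq_or_ne x y with rfl | hxy
  · simp [Real.zero_rpow hγ₀.ne']
  have hcount : ∑ n, l.count n = k := by
    rw [← hl, hperm.length_eq, length_flatMap_replicate]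
  rw [← div_le_iff₀ (Real.rpow_pos_of_pos (norm_pos_iff.2 (sub_ne_zero.2 hxy)) _)]
  exact hC _ hcount x hx y hy hxy

lemma IsCkOn.iteratedHolder_of_succ (hΩ : IsOpen Ω) {k : ℕ} (hg : IsCkOn Ω (k + 1) g) :
    IteratedHolder (absFamily 𝕜) Ω 1 k g :=
  (hg.of_succ hΩ).iteratedHolder hΩ le_rfl one_pos fun l hl =>
    (IsCkOn.iterPartial (j := 1) l (by rwa [hl, add_comm])).1.holderOnCompacts hΩ le_rfl one_pos

end Scalar

/-! ### Local completeness and transfer of weak bounds. -/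

section LocalCompleteness

open scoped Pointwise

variable {𝕜 ι E : Type*} [RCLike 𝕜] [AddCommGroup E] [Module 𝕜 E]

/-- The intersection of the closed balls `p i ≤ M i`. -/
def seminormDisk (p : SeminormFamily 𝕜 E ι) (M : ι → ℝ) : Set E := {x | ∀ i, p i x ≤ M i}

variable {p : SeminormFamily 𝕜 E ι} {M : ι → ℝ}

lemma isClosed_seminormDisk [TopologicalSpace E] (hp : WithSeminorms p) :
    IsClosed (seminormDisk p M) := by
  simp only [seminormDisk, Set.ofPred_forall]
  exact isClosed_iInter fun i => isClosed_le (hp.continuous_seminorm i) continuous_const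

variable [Module ℝ E] [IsScalarTower ℝ 𝕜 E]

lemma seminorm_real_smul (q : Seminorm 𝕜 E) (c : ℝ) (x : E) : q (c • x) = |c| * q x := by
  rw [← algebraMap_smul 𝕜 c x, map_smul_eq_mul, norm_algebraMap', Real.norm_eq_abs]

lemma isDisk_seminormDisk [TopologicalSpace E] (hp : WithSeminorms p) :
    IsDisk 𝕜 (seminormDisk p M) where
  bounded := hp.isVonNBounded_iff_seminorm_bounded.2 fun i =>
    -- The criterion wants a positive radius and a strict inequality, while `M i` has no prescribed
    -- sign.
    ⟨|M i| + 1, by positivity, fun x hx => by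
      have := hx i
      linarith [le_abs_self (M i)]⟩
  balanced := by
    rintro a ha _ ⟨x, hx, rfl⟩ i
    change p i (a • x) ≤ M i
    rw [map_smul_eq_mul]
    exact (mul_le_of_le_one_left (apply_nonneg _ _) ha).trans (hx i)
  convex := by
    intro x hx y hy a b ha hb hab i
    calc p i (a • x + b • y) ≤ p i (a • x) + p i (b • y) := map_add_le_add _ _ _
      _ = a * p i x + b * p i y := by
        rw [seminorm_real_smul, seminorm_real_smul, abs_of_nonneg ha, abs_of_nonneg hb]
      _ ≤ a * M i + b * M i :=
        add_le_add (mul_le_mul_of_nonneg_left (hx i) ha) (mul_le_mul_of_nonneg_left (hy i) hb)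
      _ = M i := by rw [← add_mul, hab, one_mul]

lemma mem_smul_seminormDisk {c : ℝ} (hc : 0 < c) {x : E} :
    x ∈ c • seminormDisk p M ↔ ∀ i, p i x ≤ c * M i := by
  rw [Set.mem_smul_set_iff_inv_smul_mem₀ hc.ne']
  refine forall_congr' fun i => ?_
  rw [seminorm_real_smul, abs_of_pos (inv_pos.2 hc), inv_mul_le_iff₀ hc]

lemma mem_diskSpan_seminormDisk (hM : ∀ i, 0 ≤ M i) {x : E} :
    x ∈ diskSpan (seminormDisk p M) ↔ ∃ c > 0, ∀ i, p i x ≤ c * M i := by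
  constructor
  · rintro ⟨n, y, hy, rfl⟩
    refine ⟨n + 1, by positivity, fun i => ?_⟩
    rw [seminorm_real_smul, abs_of_nonneg n.cast_nonneg]
    exact mul_le_mul (by linarith) (hy i) (apply_nonneg _ _) (by positivity)
  · rintro ⟨c, hc, h⟩
    obtain ⟨n, hn⟩ := exists_nat_ge c
    have hn0 : 0 < (n : ℝ) := hc.trans_le hn
    have hx : x ∈ (n : ℝ) • seminormDisk p M := (mem_smul_seminormDisk hn0).2 fun i =>
      (h i).trans (mul_le_mul_of_nonneg_right hn (hM i))
    obtain ⟨y, hy, rfl⟩ := hx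
    exact ⟨n, y, hy, rfl⟩

lemma sub_mem_diskSpan_seminormDisk (hM : ∀ i, 0 ≤ M i) {x y : E}
    (hx : x ∈ diskSpan (seminormDisk p M)) (hy : y ∈ diskSpan (seminormDisk p M)) :
    x - y ∈ diskSpan (seminormDisk p M) := by
  obtain ⟨a, ha, hxa⟩ := (mem_diskSpan_seminormDisk hM).1 hx
  obtain ⟨b, hb, hyb⟩ := (mem_diskSpan_seminormDisk hM).1 hy
  refine (mem_diskSpan_seminormDisk hM).2 ⟨a + b, by positivity, fun i => ?_⟩
  rw [add_mul]
  exact (map_sub_le_add (p i) x y).trans (add_le_add (hxa i) (hyb i))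

/-- Gauge convergence therefore implies convergence for every `p i`. Attainment of the infimum is
not assumed: use radii below the gauge plus `ε` and let `ε` tend to zero. -/
lemma seminorm_le_gauge_mul (hM : ∀ i, 0 ≤ M i) {x : E}
    (hx : x ∈ diskSpan (seminormDisk p M)) (i : ι) :
    p i x ≤ gauge (seminormDisk p M) x * M i := by
  obtain ⟨c, hc, hxc⟩ := (mem_diskSpan_seminormDisk hM).1 hx
  have hne : {r : ℝ | 0 < r ∧ x ∈ r • seminormDisk p M}.Nonempty :=
    ⟨c, hc, (mem_smul_seminormDisk hc).2 hxc⟩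
  have key : ∀ ε > 0, p i x ≤ (gauge (seminormDisk p M) x + ε) * M i := by
    intro ε hε
    obtain ⟨r, ⟨hr, hxr⟩, hlt⟩ := exists_lt_of_csInf_lt hne
      (show sInf {r : ℝ | 0 < r ∧ x ∈ r • seminormDisk p M} < gauge (seminormDisk p M) x + ε from
        lt_add_of_pos_right _ hε)
    exact ((mem_smul_seminormDisk hr).1 hxr i).trans (mul_le_mul_of_nonneg_right hlt.le (hM i))
  have hlim : Tendsto (fun ε : ℝ => (gauge (seminormDisk p M) x + ε) * M i) (𝓝[>] 0)
      (𝓝 ((gauge (seminormDisk p M) x + 0) * M i)) :=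
    ((tendsto_const_nhds.add tendsto_id).mul_const _).mono_left nhdsWithin_le_nhds
  rw [add_zero] at hlim
  exact ge_of_tendsto hlim (by filter_upwards [self_mem_nhdsWithin] with ε hε using key ε hε)

/-- In a locally complete space a family converges if it satisfies a Cauchy condition whose rate
is the same, up to constants, for all seminorms. -/
lemma LocallyComplete.exists_tendsto [TopologicalSpace E] [IsTopologicalAddGroup E]
    (hp : WithSeminorms p) (hE : LocallyComplete 𝕜 E) {α : Type*} {l : Filter α} [l.NeBot]
    [l.IsCountablyGenerated] {A : Set α} (hA : A ∈ l) {q : α → E} {ω : α → ℝ}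
    (hω : Tendsto ω l (𝓝 0)) (hM : ∀ i, 0 ≤ M i)
    (h : ∀ s ∈ A, ∀ t ∈ A, 0 < ω s + ω t ∧ ∀ i, p i (q s - q t) ≤ M i * (ω s + ω t)) :
    ∃ v, Tendsto q l (𝓝 v) := by
  -- Completeness of `E_D` is sequential, so a limit is found along one sequence and then shown to
  -- be the limit along `l`.
  obtain ⟨a, ha⟩ := l.exists_seq_tendsto
  obtain ⟨N, hN⟩ := eventually_atTop.1 (ha.eventually hA)
  set b : ℕ → α := fun n => a (n + N) with hb
  have hbA : ∀ n, b n ∈ A := fun n => hN _ (Nat.le_add_left _ _)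
  have hbω : Tendsto (fun n => ω (b n)) atTop (𝓝 0) :=
    (hω.comp ha).comp (tendsto_add_atTop_nat N)
  set D := seminormDisk p M
  -- Only differences of values of `q` are known to lie in `E_D`, hence the subtraction of `q (b
  -- 0)`.
  have hu : ∀ n, q (b n) - q (b 0) ∈ diskSpan D := fun n =>
    (mem_diskSpan_seminormDisk hM).2 ⟨ω (b n) + ω (b 0), (h _ (hbA n) _ (hbA 0)).1, fun i => by
      rw [mul_comm]
      exact (h _ (hbA n) _ (hbA 0)).2 i⟩
  obtain ⟨x, hx, hlim⟩ := hE D (isClosed_seminormDisk hp) (isDisk_seminormDisk hp)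
    (fun n => q (b n) - q (b 0)) hu (by
      intro ε hε
      obtain ⟨n₀, hn₀⟩ := eventually_atTop.1
        (hbω.eventually_lt_const (show (0 : ℝ) < ε / 4 by positivity))
      refine ⟨n₀, fun m hm n hn => ?_⟩
      refine lt_of_le_of_lt (b := ε / 2) (gauge_le_of_mem (by positivity) ?_) (by linarith)
      refine (mem_smul_seminormDisk (by positivity)).2 fun i => ?_
      rw [sub_sub_sub_cancel_right, mul_comm]
      exact ((h _ (hbA m) _ (hbA n)).2 i).trans
        (mul_le_mul_of_nonneg_left (by linarith [hn₀ m hm, hn₀ n hn]) (hM i)))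
  refine ⟨q (b 0) + x, (hp.tendsto_nhds q _).2 fun i ε hε => ?_⟩
  -- Compare `q t` with `q (b n)` and let `n` tend to infinity.
  have hbound : ∀ t ∈ A, p i (q t - (q (b 0) + x)) ≤ M i * ω t := by
    intro t ht
    have h1 : ∀ n, p i (q t - (q (b 0) + x)) ≤
        M i * (ω t + ω (b n)) + gauge D (q (b n) - q (b 0) - x) * M i := by
      intro n
      calc p i (q t - (q (b 0) + x)) = p i ((q t - q (b n)) + (q (b n) - q (b 0) - x)) := by
            congr 1
            abel
        _ ≤ p i (q t - q (b n)) + p i (q (b n) - q (b 0) - x) := map_add_le_add _ _ _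
        _ ≤ _ := add_le_add ((h _ ht _ (hbA n)).2 i)
            (seminorm_le_gauge_mul hM (sub_mem_diskSpan_seminormDisk hM (hu n) hx) i)
    have h2 : Tendsto (fun n => M i * (ω t + ω (b n)) + gauge D (q (b n) - q (b 0) - x) * M i)
        atTop (𝓝 (M i * (ω t + 0) + 0 * M i)) :=
      ((tendsto_const_nhds.add hbω).const_mul _).add (hlim.mul_const _)
    simpa using ge_of_tendsto' h2 h1
  have h0 : Tendsto (fun t => M i * ω t) l (𝓝 0) := by simpa using hω.const_mul (M i)
  filter_upwards [hA, h0.eventually_lt_const hε] with t ht htε using (hbound t ht).trans_lt htε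

/-- Weak bounds give bounds for all seminorms. -/
lemma DeterminesBoundedness.exists_seminorm_le [TopologicalSpace E]
    (hp : WithSeminorms p) {G : Submodule 𝕜 (StrongDual 𝕜 E)} (hG : DeterminesBoundedness G)
    {α : Type*} {S : Set α} {u : α → E} {w : α → ℝ} (hw : ∀ s ∈ S, 0 < w s)
    (h : ∀ e' ∈ G, ∃ C : ℝ, ∀ s ∈ S, ‖e' (u s)‖ ≤ C * w s) :
    ∃ M : ι → ℝ, (∀ i, 0 ≤ M i) ∧ ∀ i, ∀ s ∈ S, p i (u s) ≤ M i * w s := by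
  -- Dividing by the weight turns the weak estimates into weak boundedness of a single set.
  have hb : Bornology.IsVonNBounded 𝕜 ((fun s => (w s)⁻¹ • u s) '' S) := by
    refine hG _ fun e' he' => ?_
    obtain ⟨C, hC⟩ := h e' he'
    refine ⟨C, ?_⟩
    rintro _ ⟨s, hs, rfl⟩
    have hws := hw s hs
    rw [ContinuousLinearMap.map_smul_of_tower, norm_smul, Real.norm_eq_abs,
      abs_of_pos (inv_pos.2 hws), inv_mul_le_iff₀ hws, mul_comm]
    exact hC s hs
  choose M hM0 hM using hp.isVonNBounded_iff_seminorm_bounded.1 hb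
  refine ⟨M, fun i => (hM0 i).le, fun i s hs => ?_⟩
  have hws := hw s hs
  have h1 := (hM i _ (Set.mem_image_of_mem _ hs)).le
  rw [seminorm_real_smul, abs_of_pos (inv_pos.2 hws), inv_mul_le_iff₀ hws, mul_comm] at h1
  exact h1

end LocalCompleteness

/-! ### Rate of convergence of difference quotients. -/

section DifferenceQuotients

variable {d : ℕ} {F : Type*} [NormedAddCommGroup F] [NormedSpace ℝ F]

lemma norm_diffQuot_sub_le {g : EuclideanSpace ℝ (Fin d) → F} {n : Fin d}
    {g' : EuclideanSpace ℝ (Fin d) → F} {x : EuclideanSpace ℝ (Fin d)} {C γ h : ℝ} (hγ : 0 < γ)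
    (hC0 : 0 ≤ C) (hh : h ≠ 0)
    (hg : ∀ t ∈ Set.uIcc 0 h, HasLineDerivAt ℝ g (g' (x + t • EuclideanSpace.single n (1 : ℝ)))
      (x + t • EuclideanSpace.single n (1 : ℝ)) (EuclideanSpace.single n (1 : ℝ)))
    (hC : ∀ t ∈ Set.uIcc 0 h,
      ‖g' (x + t • EuclideanSpace.single n (1 : ℝ)) - g' x‖ ≤ C * |t| ^ γ) :
    ‖diffQuot n g x h - g' x‖ ≤ C * |h| ^ γ := by
  set e : EuclideanSpace ℝ (Fin d) := EuclideanSpace.single n (1 : ℝ)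
  -- Only the value `g' x` of `L` on `e` matters: subtracting `L` reduces the claim to the mean
  -- value inequality with the small derivative `g' z - g' x`.
  set L := linearOfPartials (d := d) fun _ => g' x with hL
  have hLe : L e = g' x := linearOfPartials_single _ n
  have key := norm_sub_le_of_hasLineDerivAt (g := fun z => g z - L z) (g' := fun z => g' z - g' x)
    (z := x) (e := e) (a := h) (C := C * |h| ^ γ)
    (fun t ht => by
      have h1 := (L.hasFDerivAt (x := x + t • e)).hasLineDerivAt e
      rw [hLe] at h1
      exact HasDerivAt.sub (hg t ht) h1)
    (fun t ht => (hC t ht).trans (by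
      have : |t| ≤ |h| := by
        simpa using Set.abs_sub_left_of_mem_uIcc ht
      gcongr))
  have heq : diffQuot n g x h - g' x = h⁻¹ • (g (x + h • e) - L (x + h • e) - (g x - L x)) := by
    rw [map_add, map_smul, hLe, diffQuot, eq_inv_smul_iff₀ hh, smul_sub, smul_inv_smul₀ hh]
    abel
  rw [heq, norm_smul, norm_inv, Real.norm_eq_abs, inv_mul_le_iff₀ (abs_pos.2 hh), mul_comm]
  exact key

end DifferenceQuotients

/-! ### From weak to strong regularity. -/

section WeakToStrong

variable {𝕜 ι E : Type*} [RCLike 𝕜] [AddCommGroup E] [Module 𝕜 E] [Module ℝ E]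
  [IsScalarTower ℝ 𝕜 E] [TopologicalSpace E] {p : SeminormFamily 𝕜 E ι}
  {G : Submodule 𝕜 (StrongDual 𝕜 E)} {d : ℕ} {Ω : Set (EuclideanSpace ℝ (Fin d))} {γ : ℝ}
  {f : EuclideanSpace ℝ (Fin d) → E}

lemma holderOnCompacts_of_weak (hp : WithSeminorms p) (hG : DeterminesBoundedness G) (hγ : 0 < γ)
    (h : ∀ e' ∈ G, HolderOnCompacts (absFamily 𝕜) Ω γ fun x => e' (f x)) :
    HolderOnCompacts p Ω γ f := by
  intro K hK hKc i
  obtain ⟨M, -, hM⟩ := hG.exists_seminorm_le hp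
    (S := {z : EuclideanSpace ℝ (Fin d) × EuclideanSpace ℝ (Fin d) |
      z.1 ∈ K ∧ z.2 ∈ K ∧ z.1 ≠ z.2})
    (u := fun z => f z.1 - f z.2) (w := fun z => ‖z.1 - z.2‖ ^ γ)
    (fun z hz => Real.rpow_pos_of_pos (norm_pos_iff.2 (sub_ne_zero.2 hz.2.2)) _)
    (fun e' he' => by
      obtain ⟨C, hC⟩ := h e' he' K hK hKc 0
      refine ⟨C, fun z hz => ?_⟩
      rw [map_sub]
      exact hC _ hz.1 _ hz.2.1)
  refine ⟨M i, fun x hx y hy => ?_⟩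
  rcases eq_or_ne x y with rfl | hxy
  · simp [Real.zero_rpow hγ.ne']
  · exact hM i (x, y) ⟨hx, hy, hxy⟩

lemma apply_diffQuot (e' : StrongDual 𝕜 E) (n : Fin d) (x : EuclideanSpace ℝ (Fin d)) (h : ℝ) :
    e' (diffQuot n f x h) = diffQuot n (fun x => e' (f x)) x h := by
  rw [diffQuot, diffQuot, ContinuousLinearMap.map_smul_of_tower, map_sub]

lemma exists_tendsto_diffQuot_of_weak [IsTopologicalAddGroup E] (hp : WithSeminorms p)
    (hE : LocallyComplete 𝕜 E) (hG : DeterminesBoundedness G) (hΩ : IsOpen Ω) (hγ : 0 < γ)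
    (n : Fin d)
    (hd : ∀ e' ∈ G, ∀ x ∈ Ω, ∃ v : 𝕜,
      Tendsto (diffQuot n (fun x => e' (f x)) x) (𝓝[≠] (0 : ℝ)) (𝓝 v))
    (h : ∀ e' ∈ G, HolderOnCompacts (absFamily 𝕜) Ω γ (partialDeriv n fun x => e' (f x)))
    {x : EuclideanSpace ℝ (Fin d)} (hx : x ∈ Ω) :
    ∃ v : E, Tendsto (diffQuot n f x) (𝓝[≠] (0 : ℝ)) (𝓝 v) := by
  set e : EuclideanSpace ℝ (Fin d) := EuclideanSpace.single n (1 : ℝ) with he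
  have hcont : Continuous fun t : ℝ => x + t • e := by fun_prop
  have hnhds : (fun t : ℝ => x + t • e) ⁻¹' Ω ∈ 𝓝 (0 : ℝ) :=
    (hΩ.preimage hcont).mem_nhds (by simpa using hx)
  obtain ⟨r, hr, hball⟩ := Metric.nhds_basis_closedBall.mem_iff.1 hnhds
  -- Every point at which the mean value argument evaluates the derivative lies on this compact
  -- segment.
  set K := (fun t : ℝ => x + t • e) '' Metric.closedBall 0 r with hKdef
  have hK : K ⊆ Ω := Set.image_subset_iff.2 hball
  have hKc : IsCompact K := (isCompact_closedBall 0 r).image hcont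
  set A : Set ℝ := Metric.closedBall 0 r ∩ {0}ᶜ with hAdef
  have hA : A ∈ 𝓝[≠] (0 : ℝ) :=
    inter_mem (nhdsWithin_le_nhds (Metric.closedBall_mem_nhds _ hr)) self_mem_nhdsWithin
  have hpos : ∀ s ∈ A, 0 < |s| ^ γ := fun s hs => Real.rpow_pos_of_pos (abs_pos.2 hs.2) _
  have hweak : ∀ e' ∈ G, ∃ C : ℝ, ∀ s ∈ A,
      ‖diffQuot n (fun x => e' (f x)) x s - partialDeriv n (fun x => e' (f x)) x‖
        ≤ C * |s| ^ γ := by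
    intro e' he'
    obtain ⟨C, hC⟩ := h e' he' K hK hKc 0
    refine ⟨|C|, fun s hs => ?_⟩
    have hmem : ∀ t ∈ Set.uIcc 0 s, x + t • e ∈ K := fun t ht => by
      refine Set.mem_image_of_mem _ ?_
      have h1 : |t| ≤ |s| := by simpa using Set.abs_sub_left_of_mem_uIcc ht
      have h2 : |s| ≤ r := by simpa using hs.1
      simpa using h1.trans h2
    have hxK : x ∈ K := by simpa using hmem 0 Set.left_mem_uIcc
    refine norm_diffQuot_sub_le (g' := partialDeriv n fun x => e' (f x)) hγ (abs_nonneg C) hs.2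
      (fun t ht => ?_) (fun t ht => ?_)
    · obtain ⟨v, hv⟩ := hd e' he' _ (hK (hmem t ht))
      rw [hasLineDerivAt_iff_tendsto_diffQuot, partialDeriv, hv.limUnder_eq]
      exact hv
    · refine (hC _ (hmem t ht) x hxK).trans ?_
      have : ‖x + t • e - x‖ = |t| := by simp [he, norm_smul]
      rw [this]
      exact mul_le_mul_of_nonneg_right (le_abs_self C) (Real.rpow_nonneg (abs_nonneg _) _)
  -- Taking differences of two quotients eliminates the scalar derivative, which is not yet known to
  -- come from an element of `E`.
  obtain ⟨M, hM0, hM⟩ := hG.exists_seminorm_le hp (S := A ×ˢ A)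
    (u := fun z => diffQuot n f x z.1 - diffQuot n f x z.2) (w := fun z => |z.1| ^ γ + |z.2| ^ γ)
    (fun z hz => add_pos (hpos _ hz.1) (hpos _ hz.2))
    (fun e' he' => by
      obtain ⟨C, hC⟩ := hweak e' he'
      refine ⟨C, fun z hz => ?_⟩
      rw [map_sub, apply_diffQuot, apply_diffQuot, mul_add,
        ← sub_sub_sub_cancel_right _ _ (partialDeriv n (fun x => e' (f x)) x)]
      exact (norm_sub_le _ _).trans (add_le_add (hC _ hz.1) (hC _ hz.2)))
  have hω : Tendsto (fun t : ℝ => |t| ^ γ) (𝓝[≠] 0) (𝓝 0) := by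
    have : Continuous fun t : ℝ => |t| ^ γ := continuous_abs.rpow_const fun _ => Or.inr hγ.le
    have h0 := this.tendsto 0
    rw [abs_zero, Real.zero_rpow hγ.ne'] at h0
    exact h0.mono_left nhdsWithin_le_nhds
  exact hE.exists_tendsto hp hA hω hM0 fun s hs t ht =>
    ⟨add_pos (hpos s hs) (hpos t ht), fun i => hM i (s, t) ⟨hs, ht⟩⟩

lemma iteratedHolder_of_weak [IsTopologicalAddGroup E] [T2Space E] (hp : WithSeminorms p)
    (hE : LocallyComplete 𝕜 E) (hG : DeterminesBoundedness G) (hΩ : IsOpen Ω) (hγ : 0 < γ)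
    {k : ℕ} (h : ∀ e' ∈ G, IteratedHolder (absFamily 𝕜) Ω γ k fun x => e' (f x)) :
    IteratedHolder p Ω γ k f := by
  induction k generalizing f with
  | zero => exact holderOnCompacts_of_weak hp hG hγ h
  | succ k ih =>
    have hex : ∀ n : Fin d, ∀ x ∈ Ω, ∃ v : E,
        Tendsto (diffQuot n f x) (𝓝[≠] (0 : ℝ)) (𝓝 v) := fun n x hx =>
      exists_tendsto_diffQuot_of_weak hp hE hG hΩ hγ n (fun e' he' => (h e' he').2.1 n)
        (fun e' he' => ((h e' he').2.2 n).holderOnCompacts) hx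
    refine ⟨holderOnCompacts_of_weak hp hG hγ fun e' he' => (h e' he').1, hex, fun n => ih ?_⟩
    -- On `Ω`, where the strong derivative now exists, `e'` commutes with it by continuity;
    -- elsewhere both derivatives may be default values.
    refine fun e' he' => ((h e' he').2.2 n).congr hΩ fun x hx => ?_
    obtain ⟨v, hv⟩ := hex n x hx
    have hv' : Tendsto (diffQuot n (fun x => e' (f x)) x) (𝓝[≠] (0 : ℝ)) (𝓝 (e' v)) :=
      ((e'.continuous.tendsto v).comp hv).congr fun t => apply_diffQuot e' n x t
    simp only [partialDeriv]
    rw [hv.limUnder_eq, hv'.limUnder_eq]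

end WeakToStrong

end WeakStrong

theorem mainTheorem5 {𝕜 : Type*} [RCLike 𝕜] {E : Type*} [AddCommGroup E] [Module 𝕜 E]
    [Module ℝ E] [IsScalarTower ℝ 𝕜 E] [TopologicalSpace E] [IsTopologicalAddGroup E]
    [ContinuousSMul 𝕜 E] [T2Space E]
    {ι : Type*} (p : SeminormFamily 𝕜 E ι) (hp : WithSeminorms p)
    (hE : WeakStrong.LocallyComplete 𝕜 E)
    (G : Submodule 𝕜 (StrongDual 𝕜 E)) (hG : WeakStrong.DeterminesBoundedness G)
    {d : ℕ} (Ω : Set (EuclideanSpace ℝ (Fin d))) (hΩ : IsOpen Ω)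
    (k : ℕ) (γ : ℝ) (hγ₀ : 0 < γ) (hγ₁ : γ ≤ 1)
    (f : EuclideanSpace ℝ (Fin d) → E) :
    ((∀ e' ∈ G, WeakStrong.IsCkHolderLocOn (WeakStrong.absFamily 𝕜) Ω k γ (fun x => e' (f x))) →
      WeakStrong.IsCkHolderLocOn p Ω k γ f) ∧
    ((∀ e' ∈ G, WeakStrong.IsCkOn Ω (k + 1) (fun x => e' (f x))) →
      WeakStrong.IsCkHolderLocOn p Ω k 1 f) :=
  ⟨fun h => (WeakStrong.iteratedHolder_of_weak hp hE hG hΩ hγ₀ fun e' he' =>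
      (h e' he').iteratedHolder hΩ hγ₁ hγ₀).isCkHolderLocOn hp hΩ hγ₀,
    fun h => (WeakStrong.iteratedHolder_of_weak hp hE hG hΩ one_pos fun e' he' =>
      (h e' he').iteratedHolder_of_succ hΩ).isCkHolderLocOn hp hΩ one_pos⟩
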